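/- Let $n\ge 1$. Write $[n]=\{1,\dots,n\}$ and let $\mathcal{S}_n$ be the set of permutations of $[n]$, written in one-line notation $\pi=\pi(1)\pi(2)\cdots\pi(n)$. An $n$-cycle is a permutation in $\mathcal{S}_n$ consisting of one single cycle of length $n$ (for $n=1$, the identity). The descent set of a sequence of integers $a=a_1a_2\cdots a_n$ is $D(a)=\{i : 1\le i\le n-1,\ a_i>a_{i+1}\}$. Let $\mathcal{U}_n$ be the set of sequences obtained from the one-line notation $\pi(1)\pi(2)\cdots\pi(n)$ of an $n$-cycle $\pi$ by replacing exactly one entry with $n+1$. Then there is a bijection $\varphi:\mathcal{U}_n\to\mathcal{S}_n$ such that, for every $\tau\in\mathcal{U}_n$ and $\sigma=\varphi(\tau)$, $$D(\tau)=D(\sigma),$$ and, in addition, if $n+1$ is in position $k$ of $\tau$, then $\sigma(k)=n$. -/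

import Mathlib

/-- The permutations of `[n]` consisting of one single cycle of length `n`. Here `[n]` is modelled
by `Fin n`, the number `j` of `[n]` being the element of `Fin n` with value `j - 1`. For `n = 1`
this is the identity, written `(1)` in cycle form. -/
def cyclicPerms (n : ℕ) : Set (Equiv.Perm (Fin n)) :=
  {π | π.IsCycleOn Set.univ}

/-- The one-line notation `π(1) π(2) … π(n)`, with entries in `{1, …, n}`. -/
def oneLine {n : ℕ} (π : Equiv.Perm (Fin n)) : Fin n → ℤ :=
  fun i => ((π i : ℕ) : ℤ) + 1

/-- The descent set `{i : 1 ≤ i ≤ n - 1, a_i > a_{i+1}}` of a sequence `a = a_1 a_2 … a_n` of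
integers. The entry `a_i` is the value of `a` at the index `i - 1` of `Fin n`. -/
def descentSet {n : ℕ} (a : Fin n → ℤ) : Set ℕ :=
  {i | ∃ (_ : 1 ≤ i) (h : i < n), a ⟨i - 1, by omega⟩ > a ⟨i, h⟩}

/-- The sequences obtained from the one-line notation of an `n`-cycle by replacing one entry
with `n + 1`. -/
def cyclesWithEntryReplaced (n : ℕ) : Set (Fin n → ℤ) :=
  {τ | ∃ π ∈ cyclicPerms n, ∃ k : Fin n, τ = Function.update (oneLine π) k ((n : ℤ) + 1)}

/-! ### Permutations sorting words and their suffixes -/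

/-! Cutting an `n`-cycle after the replaced position gives a cycle notation `y`, so
`cyclesWithEntryReplaced` is parametrised by all permutations `y`, with the new maximum at position
`y (Fin.last m)`. It then suffices that `cycleSeq y` and `oneLine σ` are equidistributed for the
descent set together with the position of the maximum. By inclusion–exclusion, equality of descent
sets may be weakened to containment in a set `s`, that is, to being increasing on the blocks that
`s` cuts out. With `c` the block index, both sides are encoded by rearrangements of the word `c`:
`σ` by `c ∘ σ⁻¹`, recovered by stable sorting, and `y` by `c ∘ y`, recovered by ranking its suffixes
lexicographically (`inv_eq_sort_suffix`). Matching equal words is the bijection of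
`card_increasingOnFibers`; it respects the maximum by `apply_last_eq`. -/

theorem toLex_nat_lt_iff {α : Type*} [LinearOrder α] (u v : ℕ → α) :
    toLex u < toLex v ↔
      u 0 < v 0 ∨ u 0 = v 0 ∧ toLex (fun j => u (j + 1)) < toLex (fun j => v (j + 1)) := by
  constructor
  · rintro ⟨i, hi, hlt⟩
    cases i with
    | zero => exact Or.inl hlt
    | succ i => exact Or.inr ⟨hi 0 (Nat.succ_pos i), i, fun j hj => hi (j + 1) (by lia), hlt⟩
  · rintro (h | ⟨h0, i, hi, hlt⟩)
    · exact ⟨0, fun j hj => absurd hj (Nat.not_lt_zero j), h⟩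
    · refine ⟨i + 1, fun j hj => ?_, hlt⟩
      cases j with
      | zero => exact h0
      | succ j => exact hi j (by lia)

/-- The letters of the word `w`, followed by infinitely many `⊤`. -/
def letterOrTop {n : ℕ} (w : Fin n → ℕ) (i : ℕ) : WithTop ℕ :=
  if h : i < n then (w ⟨i, h⟩ : WithTop ℕ) else ⊤

/-- The suffix of `w` starting at the index `i`, followed by infinitely many `⊤`. -/
def suffix {n : ℕ} (w : Fin n → ℕ) (i : ℕ) : Lex (ℕ → WithTop ℕ) :=
  toLex fun j => letterOrTop w (i + j)

theorem letterOrTop_of_lt {n : ℕ} (w : Fin n → ℕ) (i : Fin n) :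
    letterOrTop w i = (w i : WithTop ℕ) := by
  simp [letterOrTop]

theorem letterOrTop_eq_top {n : ℕ} (w : Fin n → ℕ) {i : ℕ} :
    letterOrTop w i = ⊤ ↔ n ≤ i := by
  unfold letterOrTop
  split_ifs with h
  · simpa using h
  · simpa using h

theorem suffix_lt_iff {n : ℕ} (w : Fin n → ℕ) (i j : ℕ) :
    suffix w i < suffix w j ↔ letterOrTop w i < letterOrTop w j ∨
      letterOrTop w i = letterOrTop w j ∧ suffix w (i + 1) < suffix w (j + 1) := by
  unfold suffix
  rw [toLex_nat_lt_iff]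
  simp only [Nat.add_zero, Nat.add_right_comm _ 1, Nat.add_assoc]

/-- Suffixes with different starts have different lengths, so the padding `⊤` begins at different
places. -/
theorem suffix_injective {n : ℕ} (w : Fin n → ℕ) :
    Function.Injective fun i : Fin n => suffix w i := by
  have key : ∀ i j : Fin n, i < j → suffix w i ≠ suffix w j := by
    intro i j hij h
    have h1 : letterOrTop w (i + (n - j)) = letterOrTop w (j + (n - j)) :=
      congrFun (congrArg ofLex h) (n - (j : ℕ))
    have h2 : letterOrTop w (j + (n - j)) = ⊤ := (letterOrTop_eq_top w).2 (by lia)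
    have h3 := (letterOrTop_eq_top w).1 (h1.trans h2)
    have := j.isLt
    have : (i : ℕ) < j := hij
    lia
  intro i j h
  rcases lt_trichotomy i j with hij | hij | hij
  · exact absurd h (key i j hij)
  · exact hij
  · exact absurd h.symm (key j i hij)

/-! ### Sequences read off from cycle notation -/

/-- The entry at index `i` of the cycle notation `y 0, y 1, …, y (n - 1), n, n, …`. -/
def cycleEntry {n : ℕ} (y : Equiv.Perm (Fin n)) (i : ℕ) : ℕ :=
  if h : i < n then (y ⟨i, h⟩ : ℕ) else n

/-- The sequence sending each entry of the cycle notation `(y 0, y 1, …, y (n - 1))` to the one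
that follows it, and the last one to the new maximum. -/
def cycleSeq {n : ℕ} (y : Equiv.Perm (Fin n)) : Fin n → ℤ :=
  fun i => (cycleEntry y ((y⁻¹ i : Fin n) + 1) : ℤ) + 1

theorem cycleEntry_of_lt {n : ℕ} (y : Equiv.Perm (Fin n)) (i : Fin n) :
    cycleEntry y i = y i := by
  simp [cycleEntry]

theorem cycleEntry_of_le {n : ℕ} (y : Equiv.Perm (Fin n)) {i : ℕ} (h : n ≤ i) :
    cycleEntry y i = n := by
  simp [cycleEntry, h]

theorem cycleEntry_le {n : ℕ} (y : Equiv.Perm (Fin n)) (i : ℕ) : cycleEntry y i ≤ n := by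
  unfold cycleEntry
  split_ifs with h
  · exact (y ⟨i, h⟩).isLt.le
  · exact le_rfl

theorem cycleEntry_lt_iff {n : ℕ} (y : Equiv.Perm (Fin n)) {i : ℕ} :
    cycleEntry y i < n ↔ i < n := by
  constructor
  · intro h
    by_contra hi
    rw [cycleEntry_of_le y (by lia)] at h
    exact lt_irrefl _ h
  · intro h
    rw [cycleEntry, dif_pos h]
    exact (y ⟨i, h⟩).isLt

theorem cycleEntry_inj {n : ℕ} (y : Equiv.Perm (Fin n)) {i j : ℕ} (hi : i ≤ n) (hj : j ≤ n)
    (h : cycleEntry y i = cycleEntry y j) : i = j := by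
  by_cases hin : i < n
  · have hjn : j < n := (cycleEntry_lt_iff y).1 (h ▸ (cycleEntry_lt_iff y).2 hin)
    rw [cycleEntry, cycleEntry, dif_pos hin, dif_pos hjn] at h
    simpa using y.injective (Fin.ext h)
  · have hjn : ¬ j < n := fun hjn =>
      hin ((cycleEntry_lt_iff y).1 (h ▸ (cycleEntry_lt_iff y).2 hjn))
    lia

theorem cycleSeq_apply {n : ℕ} (y : Equiv.Perm (Fin n)) (i : Fin n) :
    cycleSeq y (y i) = (cycleEntry y (i + 1) : ℤ) + 1 := by
  simp [cycleSeq]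

theorem cycleSeq_injective {n : ℕ} (y : Equiv.Perm (Fin n)) :
    Function.Injective (cycleSeq y) := by
  intro i j h
  have h1 : cycleEntry y ((y⁻¹ i : Fin n) + 1) = cycleEntry y ((y⁻¹ j : Fin n) + 1) := by
    simpa [cycleSeq] using h
  have h2 := cycleEntry_inj y (Nat.succ_le_of_lt (y⁻¹ i).isLt) (Nat.succ_le_of_lt (y⁻¹ j).isLt) h1
  exact y⁻¹.injective (Fin.ext (by lia))

theorem cycleSeq_eq_iff {m : ℕ} (y : Equiv.Perm (Fin (m + 1))) (k : Fin (m + 1)) :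
    cycleSeq y k = ((m + 1 : ℕ) : ℤ) + 1 ↔ y (Fin.last m) = k := by
  have hl : cycleSeq y (y (Fin.last m)) = ((m + 1 : ℕ) : ℤ) + 1 := by
    rw [cycleSeq_apply, cycleEntry_of_le y (by simp)]
  constructor
  · intro h
    exact cycleSeq_injective y (hl.trans h.symm)
  · rintro rfl
    exact hl

theorem cycleSeq_le {n : ℕ} (y : Equiv.Perm (Fin n)) (k : Fin n) : cycleSeq y k ≤ (n : ℤ) + 1 := by
  have := cycleEntry_le y ((y⁻¹ k : Fin n) + 1)
  unfold cycleSeq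
  lia

/-! ### Sequences increasing on the blocks of a set composition -/

/-- The sequence `a` is strictly increasing on every fibre of `c`. -/
def IncreasingOnFibers {n : ℕ} {α : Type*} [LT α] (c : Fin n → ℕ) (a : Fin n → α) : Prop :=
  ∀ i j, i < j → c i = c j → a i < a j

/-- If two entries lie in the same block, monotonicity there passes the inequality on to their
successors in the cycle notation. The end value `n` matches the padding `⊤`. -/
theorem suffix_lt_of_cycleEntry_lt {n : ℕ} {c : Fin n → ℕ} (hc : Monotone c)
    {y : Equiv.Perm (Fin n)} (hy : IncreasingOnFibers c (cycleSeq y)) (i j : ℕ)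
    (h : cycleEntry y i < cycleEntry y j) : suffix (c ∘ y) i < suffix (c ∘ y) j := by
  induction hd : n - i generalizing i j with
  | zero =>
    rw [cycleEntry_of_le y (by lia : n ≤ i)] at h
    exact absurd h (not_lt.2 (cycleEntry_le y j))
  | succ d ih =>
    have hi : i < n := by lia
    rw [suffix_lt_iff]
    by_cases hj : j < n
    · lift i to Fin n using hi
      lift j to Fin n using hj
      rw [cycleEntry_of_lt, cycleEntry_of_lt] at h
      rw [letterOrTop_of_lt, letterOrTop_of_lt]
      have hle : c (y i) ≤ c (y j) := hc (le_of_lt h)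
      rcases hle.lt_or_eq with hlt | heq
      · exact Or.inl (by exact_mod_cast hlt)
      · refine Or.inr ⟨by exact_mod_cast heq, ih _ _ ?_ (by lia)⟩
        have := hy _ _ h heq
        rw [cycleSeq_apply, cycleSeq_apply] at this
        lia
    · left
      rw [(letterOrTop_eq_top _).2 (not_lt.1 hj), lt_top_iff_ne_top, ne_eq, letterOrTop_eq_top]
      lia

theorem inv_eq_sort_suffix {n : ℕ} {c : Fin n → ℕ} (hc : Monotone c)
    {y : Equiv.Perm (Fin n)} (hy : IncreasingOnFibers c (cycleSeq y)) :
    y⁻¹ = Tuple.sort fun i : Fin n => suffix (c ∘ y) i := by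
  have hmono : StrictMono ((fun i : Fin n => suffix (c ∘ y) i) ∘ ⇑y⁻¹) := by
    intro i j hij
    refine suffix_lt_of_cycleEntry_lt hc hy _ _ ?_
    simpa [cycleEntry_of_lt] using hij
  rw [Tuple.eq_sort_iff]
  exact ⟨hmono.monotone, fun i j hij h => absurd h (hmono hij).ne⟩

/-- The permutation listing the ranks of the suffixes of `w` in lexicographic order. -/
noncomputable def suffixRank {n : ℕ} (w : Fin n → ℕ) : Equiv.Perm (Fin n) :=
  (Tuple.sort fun i : Fin n => suffix w i)⁻¹

theorem suffixRank_lt_iff {n : ℕ} (w : Fin n → ℕ) (i j : Fin n) :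
    suffixRank w i < suffixRank w j ↔ suffix w i < suffix w j := by
  have hmono : StrictMono ((fun i : Fin n => suffix w i) ∘ ⇑(suffixRank w)⁻¹) := by
    refine Monotone.strictMono_of_injective ?_
      ((suffix_injective w).comp (suffixRank w)⁻¹.injective)
    simpa [suffixRank] using Tuple.monotone_sort fun i : Fin n => suffix w i
  have := hmono.lt_iff_lt (a := suffixRank w i) (b := suffixRank w j)
  simp only [Function.comp_apply, Equiv.Perm.inv_def, Equiv.symm_apply_apply] at this
  exact this.symm

theorem monotone_comp_suffixRank_inv {n : ℕ} (w : Fin n → ℕ) :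
    Monotone (w ∘ ⇑(suffixRank w)⁻¹) := by
  intro i j hij
  rcases hij.lt_or_eq with hlt | rfl
  · have h : suffix w ((suffixRank w)⁻¹ i : Fin n) < suffix w ((suffixRank w)⁻¹ j : Fin n) := by
      rw [← suffixRank_lt_iff]
      simpa using hlt
    rw [suffix_lt_iff, letterOrTop_of_lt, letterOrTop_of_lt] at h
    rcases h with h | h
    · exact le_of_lt (by exact_mod_cast h)
    · exact le_of_eq (by exact_mod_cast h.1)
  · exact le_rfl

/-- Within a block first letters tie, so the order of two suffixes is that of their tails, whose
ranks are the values of `cycleSeq`. -/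
theorem increasingOnFibers_cycleSeq_suffixRank {n : ℕ} (w : Fin n → ℕ) :
    IncreasingOnFibers (w ∘ ⇑(suffixRank w)⁻¹) (cycleSeq (suffixRank w)) := by
  intro i j hij hcij
  obtain ⟨a, rfl⟩ := (suffixRank w).surjective i
  obtain ⟨b, rfl⟩ := (suffixRank w).surjective j
  rw [suffixRank_lt_iff, suffix_lt_iff, letterOrTop_of_lt, letterOrTop_of_lt] at hij
  simp only [Function.comp_apply, Equiv.Perm.inv_def, Equiv.symm_apply_apply] at hcij
  have hlt : suffix w (a + 1) < suffix w (b + 1) := by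
    rcases hij with h | h
    · exact absurd hcij (ne_of_lt (by exact_mod_cast h))
    · exact h.2
  rw [cycleSeq_apply, cycleSeq_apply]
  -- An empty suffix is constantly `⊤`, hence below no other.
  have ha : (a : ℕ) + 1 < n := by
    by_contra ha
    obtain ⟨l, -, hl⟩ := hlt
    have : letterOrTop w (a + 1 + l) = ⊤ := (letterOrTop_eq_top w).2 (by lia)
    have hl' : letterOrTop w (a + 1 + l) < letterOrTop w (b + 1 + l) := hl
    exact not_top_lt (this ▸ hl')
  by_cases hb : (b : ℕ) + 1 < n
  · have := (suffixRank_lt_iff w ⟨a + 1, ha⟩ ⟨b + 1, hb⟩).2 hlt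
    simp only [cycleEntry, dif_pos ha, dif_pos hb]
    have : (suffixRank w ⟨a + 1, ha⟩ : ℕ) < suffixRank w ⟨b + 1, hb⟩ := this
    lia
  · rw [cycleEntry_of_le _ (not_lt.1 hb)]
    have := (cycleEntry_lt_iff (suffixRank w)).2 ha
    lia

theorem comp_perm_eq_of_monotone {n : ℕ} {c : Fin n → ℕ} (hc : Monotone c)
    {ρ : Equiv.Perm (Fin n)} (h : Monotone (c ∘ ρ)) : c ∘ ρ = c :=
  Tuple.unique_monotone (σ := ρ) (τ := 1) h hc

theorem increasingOnFibers_sort {n : ℕ} {c : Fin n → ℕ} (hc : Monotone c)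
    (y : Equiv.Perm (Fin n)) :
    c ∘ y ∘ Tuple.sort (c ∘ y) = c ∧ IncreasingOnFibers c (Tuple.sort (c ∘ y)) := by
  obtain ⟨hmono, hties⟩ := Tuple.eq_sort_iff.1 (rfl : Tuple.sort (c ∘ y) = _)
  have hcomp : c ∘ y ∘ Tuple.sort (c ∘ y) = c :=
    comp_perm_eq_of_monotone (ρ := y * Tuple.sort (c ∘ y)) hc hmono
  refine ⟨hcomp, fun i j hij hcij => hties i j hij ?_⟩
  have hi := congrFun hcomp i
  have hj := congrFun hcomp j
  simp only [Function.comp_apply] at hi hj ⊢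
  rw [hi, hj, hcij]

/-- A word has only one weakly increasing rearrangement, here `c`. -/
theorem comp_suffixRank {n : ℕ} {c : Fin n → ℕ} (hc : Monotone c) (σ : Equiv.Perm (Fin n)) :
    c ∘ suffixRank (c ∘ σ) = c ∘ σ := by
  have h := comp_perm_eq_of_monotone (ρ := σ * (suffixRank (c ∘ σ))⁻¹) hc
    (monotone_comp_suffixRank_inv (c ∘ σ))
  funext i
  have := congrFun h (suffixRank (c ∘ σ) i)
  simpa using this.symm

/-- Each side is the position of an overall maximum, hence the last position of its block. -/
theorem apply_last_eq {m : ℕ} {c : Fin (m + 1) → ℕ} {y σ : Equiv.Perm (Fin (m + 1))}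
    (hy : IncreasingOnFibers c (cycleSeq y)) (hσ : IncreasingOnFibers c σ)
    (h : c (y (Fin.last m)) = c (σ⁻¹ (Fin.last m))) : y (Fin.last m) = σ⁻¹ (Fin.last m) := by
  rcases lt_trichotomy (y (Fin.last m)) (σ⁻¹ (Fin.last m)) with hlt | heq | hlt
  · have h1 := hy _ _ hlt h
    rw [(cycleSeq_eq_iff y _).2 rfl] at h1
    exact absurd h1 (not_lt.2 (cycleSeq_le y _))
  · exact heq
  · have h1 := hσ _ _ hlt h.symm
    rw [Equiv.Perm.inv_def, Equiv.apply_symm_apply] at h1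
    exact absurd h1 (not_lt.2 (Fin.le_last _))

open Classical in
theorem card_increasingOnFibers {m : ℕ} {c : Fin (m + 1) → ℕ} (hc : Monotone c)
    (k : Fin (m + 1)) :
    (Finset.univ.filter fun y : Equiv.Perm (Fin (m + 1)) =>
        IncreasingOnFibers c (cycleSeq y) ∧ y (Fin.last m) = k).card =
      (Finset.univ.filter fun σ : Equiv.Perm (Fin (m + 1)) =>
        IncreasingOnFibers c σ ∧ σ⁻¹ (Fin.last m) = k).card := by
  refine Finset.card_nbij' (fun y => Tuple.sort (c ∘ y)) (fun σ => suffixRank (c ∘ ⇑σ⁻¹))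
    ?_ ?_ ?_ ?_
  · intro y hy
    simp only [Finset.coe_filter, Finset.mem_univ, true_and, Set.mem_ofPred_eq] at hy ⊢
    obtain ⟨h1, h2⟩ := increasingOnFibers_sort hc y
    refine ⟨h2, (apply_last_eq hy.1 h2 ?_).symm.trans hy.2⟩
    have := congrFun h1 ((Tuple.sort (c ∘ y))⁻¹ (Fin.last m))
    simpa using this
  · intro σ hσ
    simp only [Finset.coe_filter, Finset.mem_univ, true_and, Set.mem_ofPred_eq] at hσ ⊢
    have h1 := comp_suffixRank hc σ⁻¹
    have h2 : IncreasingOnFibers c (cycleSeq (suffixRank (c ∘ ⇑σ⁻¹))) := by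
      have h3 := increasingOnFibers_cycleSeq_suffixRank (c ∘ ⇑σ⁻¹)
      have h4 : (c ∘ ⇑σ⁻¹) ∘ ⇑(suffixRank (c ∘ ⇑σ⁻¹))⁻¹ = c := by
        funext i
        have := congrFun h1 ((suffixRank (c ∘ ⇑σ⁻¹))⁻¹ i)
        simpa using this.symm
      rwa [h4] at h3
    exact ⟨h2, (apply_last_eq h2 hσ.1 (congrFun h1 _)).trans hσ.2⟩
  · intro y hy
    simp only [Finset.coe_filter, Finset.mem_univ, true_and, Set.mem_ofPred_eq] at hy
    obtain ⟨h1, -⟩ := increasingOnFibers_sort hc y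
    have h2 : c ∘ ⇑(Tuple.sort (c ∘ y))⁻¹ = c ∘ y := by
      funext i
      have := congrFun h1 ((Tuple.sort (c ∘ y))⁻¹ i)
      simpa using this.symm
    simp only [h2]
    rw [suffixRank, ← inv_eq_sort_suffix hc hy.1, inv_inv]
  · intro σ hσ
    simp only [Finset.coe_filter, Finset.mem_univ, true_and, Set.mem_ofPred_eq] at hσ
    simp only [comp_suffixRank hc σ⁻¹]
    refine (Tuple.eq_sort_iff.2 ⟨?_, ?_⟩).symm
    · intro i j hij
      simpa using hc hij
    · intro i j hij h
      exact hσ.1 i j hij (by simpa using h)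

/-! ### Descent sets -/

/-- The number of elements of `s` that are at most `i`. -/
def blockIndex {n : ℕ} (s : Finset ℕ) (i : Fin n) : ℕ :=
  (s.filter (· ≤ (i : ℕ))).card

theorem monotone_blockIndex {n : ℕ} (s : Finset ℕ) :
    Monotone (blockIndex s : Fin n → ℕ) := by
  intro i j hij
  refine Finset.card_le_card fun x hx => ?_
  rw [Finset.mem_filter] at hx ⊢
  exact ⟨hx.1, hx.2.trans hij⟩

theorem blockIndex_eq_iff {n : ℕ} (s : Finset ℕ) {i j : Fin n} (hij : i ≤ j) :
    blockIndex s i = blockIndex s j ↔ ∀ x ∈ s, x ≤ (j : ℕ) → x ≤ (i : ℕ) := by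
  have hsub : s.filter (· ≤ (i : ℕ)) ⊆ s.filter (· ≤ (j : ℕ)) := by
    intro x hx
    rw [Finset.mem_filter] at hx ⊢
    exact ⟨hx.1, hx.2.trans hij⟩
  constructor
  · intro h x hx hxj
    have := Finset.eq_of_subset_of_card_le hsub h.ge
    have hmem : x ∈ s.filter (· ≤ (j : ℕ)) := Finset.mem_filter.2 ⟨hx, hxj⟩
    rw [← this] at hmem
    exact (Finset.mem_filter.1 hmem).2
  · intro h
    refine congrArg Finset.card (Finset.Subset.antisymm hsub fun x hx => ?_)
    rw [Finset.mem_filter] at hx ⊢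
    exact ⟨hx.1, h x hx.1 hx.2⟩

/-- A descent `i` compares the indices `i - 1` and `i` of `Fin n`, and these share a block exactly
when `i ∉ s`. -/
theorem descentSet_subset_iff {n : ℕ} {a : Fin n → ℤ} (ha : Function.Injective a)
    (s : Finset ℕ) : descentSet a ⊆ s ↔ IncreasingOnFibers (blockIndex s) a := by
  constructor
  · rintro h ⟨i, hi⟩ ⟨j, hj⟩ hij hc
    rw [blockIndex_eq_iff s hij.le] at hc
    simp only [Fin.mk_lt_mk] at hij hc
    induction j, hij using Nat.le_induction with
    | base =>
      refine lt_of_le_of_ne (not_lt.1 fun hlt => ?_) fun heq => by simpa using ha heq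
      have := hc (i + 1) (h ⟨by lia, hj, hlt⟩) le_rfl
      lia
    | succ j hij ih =>
      refine (ih (by lia) fun x hx hxj => hc x hx (by lia)).trans ?_
      refine lt_of_le_of_ne (not_lt.1 fun hlt => ?_) fun heq => by simpa using ha heq
      have := hc (j + 1) (h ⟨by lia, hj, hlt⟩) le_rfl
      lia
  · rintro h i ⟨h1, hi, hgt⟩
    by_contra his
    refine lt_asymm hgt (h _ _ (Fin.mk_lt_mk.2 (by lia)) ?_)
    rw [blockIndex_eq_iff s (Fin.mk_le_mk.2 (by lia))]
    intro x hx hxi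
    have : x ≠ i := by
      rintro rfl
      exact his hx
    simp only at hxi ⊢
    lia

theorem finite_descentSet {n : ℕ} (a : Fin n → ℤ) : (descentSet a).Finite :=
  (Set.finite_lt_nat n).subset fun _ ⟨_, h, _⟩ => h

theorem oneLine_injective {n : ℕ} (σ : Equiv.Perm (Fin n)) : Function.Injective (oneLine σ) := by
  intro i j h
  simpa [oneLine, Fin.val_inj] using h

theorem increasingOnFibers_oneLine {n : ℕ} (c : Fin n → ℕ) (σ : Equiv.Perm (Fin n)) :
    IncreasingOnFibers c (oneLine σ) ↔ IncreasingOnFibers c σ := by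
  simp [IncreasingOnFibers, oneLine]

/-! ### Passing from inclusions of statistics to equalities -/

theorem card_filter_subset_eq_add {α ι : Type*} [DecidableEq ι] (A : Finset α)
    (f : α → Finset ι) (s : Finset ι) :
    (A.filter (f · ⊆ s)).card =
      (A.filter (f · = s)).card + ∑ t ∈ s.ssubsets, (A.filter (f · = t)).card := by
  have hfib := Finset.card_eq_sum_card_fiberwise (s := A.filter (f · ⊆ s)) (f := f)
    (t := s.powerset) fun x hx => by simpa using (Finset.mem_filter.1 hx).2
  rw [hfib, Finset.ssubsets, ← Finset.add_sum_erase _ _ (Finset.mem_powerset_self s)]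
  have hmem : ∀ t ∈ s.powerset,
      (A.filter (f · ⊆ s)).filter (f · = t) = A.filter (f · = t) := by
    intro t ht
    rw [Finset.filter_filter]
    refine Finset.filter_congr fun x _ => ⟨And.right, fun hx => ⟨?_, hx⟩⟩
    exact hx ▸ Finset.mem_powerset.1 ht
  rw [hmem s (Finset.mem_powerset_self s)]
  refine congrArg _ (Finset.sum_congr rfl fun t ht => ?_)
  rw [hmem t (Finset.mem_of_mem_erase ht)]

/-- Inclusion–exclusion: two finite families with equally many members having statistic contained
in `s`, for every `s`, have equally many members with statistic `s`, for every `s`. -/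
theorem card_filter_eq_of_card_filter_subset {α β ι : Type*} [DecidableEq ι] (A : Finset α)
    (B : Finset β) (f : α → Finset ι) (g : β → Finset ι)
    (h : ∀ s, (A.filter (f · ⊆ s)).card = (B.filter (g · ⊆ s)).card) (s : Finset ι) :
    (A.filter (f · = s)).card = (B.filter (g · = s)).card := by
  induction s using Finset.strongInduction with
  | H s ih =>
    have hs := h s
    rw [card_filter_subset_eq_add, card_filter_subset_eq_add, Finset.sum_congr rfl fun t ht => ih t (Finset.mem_ssubsets.1 ht)] at hs
    exact Nat.add_right_cancel hs

theorem exists_equiv_of_card_fiber_eq {α β γ : Type*} [Fintype α] [Fintype β] [DecidableEq γ]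
    (f : α → γ) (g : β → γ)
    (h : ∀ c, (Finset.univ.filter (f · = c)).card = (Finset.univ.filter (g · = c)).card) :
    ∃ e : α ≃ β, ∀ a, g (e a) = f a := by
  have hc : ∀ c, Nonempty ({a // f a = c} ≃ {b // g b = c}) := by
    intro c
    rw [← Fintype.card_eq, Fintype.card_subtype, Fintype.card_subtype, h]
  exact ⟨Equiv.ofFiberEquiv fun c => (hc c).some, fun a => Equiv.ofFiberEquiv_map _ a⟩

/-- Cycle notations and permutations are equidistributed with respect to the descent set and the
position of the maximum. -/
theorem exists_equiv_descentSet (m : ℕ) :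
    ∃ e : Equiv.Perm (Fin (m + 1)) ≃ Equiv.Perm (Fin (m + 1)), ∀ y,
      descentSet (oneLine (e y)) = descentSet (cycleSeq y) ∧
        (e y)⁻¹ (Fin.last m) = y (Fin.last m) := by
  classical
  obtain ⟨e, he⟩ := exists_equiv_of_card_fiber_eq
    (fun y : Equiv.Perm (Fin (m + 1)) =>
      ((finite_descentSet (cycleSeq y)).toFinset, y (Fin.last m)))
    (fun σ : Equiv.Perm (Fin (m + 1)) =>
      ((finite_descentSet (oneLine σ)).toFinset, σ⁻¹ (Fin.last m))) (by
      rintro ⟨s, k⟩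
      -- The position `k` stays fixed, so that inclusion–exclusion concerns the descent set alone.
      have h := card_filter_eq_of_card_filter_subset
        (Finset.univ.filter fun y : Equiv.Perm (Fin (m + 1)) => y (Fin.last m) = k)
        (Finset.univ.filter fun σ : Equiv.Perm (Fin (m + 1)) => σ⁻¹ (Fin.last m) = k)
        (fun y => (finite_descentSet (cycleSeq y)).toFinset)
        (fun σ => (finite_descentSet (oneLine σ)).toFinset) (by
          intro s
          rw [Finset.filter_filter, Finset.filter_filter]
          have := card_increasingOnFibers (monotone_blockIndex s) k
          simp only [← descentSet_subset_iff (cycleSeq_injective _),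
            ← increasingOnFibers_oneLine, ← descentSet_subset_iff (oneLine_injective _)] at this
          simpa only [Set.Finite.toFinset_subset, and_comm] using this) s
      rw [Finset.filter_filter, Finset.filter_filter] at h
      simpa only [Prod.mk.injEq, and_comm] using h)
  refine ⟨e, fun y => ?_⟩
  have h := he y
  rw [Prod.mk.injEq, Set.Finite.toFinset_inj] at h
  exact h

/-! ### Cycle notation parametrises the cycles with an entry replaced -/

theorem isCycleOn_finRotate (m : ℕ) : (finRotate (m + 1)).IsCycleOn Set.univ := by
  cases m with
  | zero =>
    have : Subsingleton (Fin (0 + 1)) := inferInstanceAs (Subsingleton (Fin 1))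
    exact Equiv.Perm.isCycleOn_of_subsingleton _ _
  | succ m =>
    have h := (isCycle_finRotate (n := m)).isCycleOn
    have hs : {x | finRotate (m + 2) x ≠ x} = Set.univ := by
      refine Set.eq_univ_of_forall fun x => ?_
      have : x ∈ (finRotate (m + 2)).support := by simp [support_finRotate]
      exact Equiv.Perm.mem_support.1 this
    rwa [hs] at h

theorem cycleSeq_mem {m : ℕ} (y : Equiv.Perm (Fin (m + 1))) :
    cycleSeq y ∈ cyclesWithEntryReplaced (m + 1) := by
  -- Conjugating the rotation by `y` gives the cycle with notation `y`.
  refine ⟨y * finRotate (m + 1) * y⁻¹, ?_, y (Fin.last m), ?_⟩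
  · have := (isCycleOn_finRotate m).conj (g := y)
    rwa [Set.image_univ, y.surjective.range_eq] at this
  · funext i
    obtain ⟨j, rfl⟩ := y.surjective i
    by_cases hj : j = Fin.last m
    · subst hj
      rw [Function.update_self]
      exact (cycleSeq_eq_iff y _).2 rfl
    · rw [Function.update_of_ne (y.injective.ne hj), cycleSeq_apply]
      have hlt : (j : ℕ) < m := Fin.val_lt_last hj
      have hrot : finRotate (m + 1) j = ⟨j + 1, Nat.succ_lt_succ hlt⟩ := finRotate_of_lt hlt
      simp [oneLine, cycleEntry, hlt, hrot, -finRotate_apply]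

/-- The position of the maximum is the last entry of `y`; the others follow by tracing preimages
backwards. -/
theorem cycleSeq_left_injective {m : ℕ} :
    Function.Injective (cycleSeq : Equiv.Perm (Fin (m + 1)) → _) := by
  intro y z h
  ext1 i
  induction i using Fin.reverseInduction with
  | last =>
    have := (cycleSeq_eq_iff y _).2 rfl
    rw [h] at this
    exact ((cycleSeq_eq_iff z _).1 this).symm
  | cast i ih =>
    have h1 := cycleSeq_apply y i.castSucc
    have h2 := cycleSeq_apply z i.castSucc
    have hy := cycleEntry_of_lt y i.succ
    have hz := cycleEntry_of_lt z i.succ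
    simp only [Fin.val_succ, Fin.val_castSucc] at h1 h2 hy hz
    rw [hy, ih, ← hz, ← h2, h] at h1
    exact cycleSeq_injective z h1

theorem exists_cycleSeq_eq {m : ℕ} {τ : Fin (m + 1) → ℤ}
    (hτ : τ ∈ cyclesWithEntryReplaced (m + 1)) : ∃ y, cycleSeq y = τ := by
  obtain ⟨π, hπ, k, rfl⟩ := hτ
  have hπ' : π.IsCycleOn ((Finset.univ : Finset (Fin (m + 1))) : Set (Fin (m + 1))) := by
    simpa [cyclicPerms] using hπ
  -- The notation starts at `π k`, so that `k`, whose image is replaced, comes last.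
  have hsurj : Function.Surjective fun i : Fin (m + 1) => (π ^ ((i : ℕ) + 1)) k := by
    intro b
    obtain ⟨l, hl, hb⟩ := hπ'.exists_pow_eq (Finset.mem_univ (π k)) (Finset.mem_univ b)
    refine ⟨⟨l, by simpa using hl⟩, ?_⟩
    simpa [pow_succ] using hb
  let y : Equiv.Perm (Fin (m + 1)) :=
    Equiv.ofBijective _ (Finite.surjective_iff_bijective.1 hsurj)
  have hy : ∀ i, y i = (π ^ ((i : ℕ) + 1)) k := fun i => rfl
  have hlast : y (Fin.last m) = k := by
    simpa [hy] using hπ'.pow_card_apply (Finset.mem_univ k)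
  refine ⟨y, ?_⟩
  funext i
  obtain ⟨j, rfl⟩ := y.surjective i
  by_cases hj : j = Fin.last m
  · subst hj
    rw [(cycleSeq_eq_iff y _).2 rfl, hlast, Function.update_self]
  · have hlt : (j : ℕ) < m := Fin.val_lt_last hj
    rw [Function.update_of_ne (hlast ▸ y.injective.ne hj), cycleSeq_apply]
    simp only [oneLine, cycleEntry, Nat.add_lt_add_iff_right, hlt, dif_pos, hy]
    rw [pow_succ' π ((j : ℕ) + 1), Equiv.Perm.mul_apply]

/-- Cycle notation as a parametrisation of the cycles with an entry replaced. -/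
noncomputable def cycleSeqEquiv (m : ℕ) :
    Equiv.Perm (Fin (m + 1)) ≃ cyclesWithEntryReplaced (m + 1) :=
  Equiv.ofBijective (fun y => ⟨cycleSeq y, cycleSeq_mem y⟩)
    ⟨fun _ _ h => cycleSeq_left_injective (congrArg Subtype.val h), fun τ => by
      obtain ⟨y, hy⟩ := exists_cycleSeq_eq τ.2
      exact ⟨y, Subtype.ext hy⟩⟩

theorem corollary2 (n : ℕ) (hn : 1 ≤ n) :
    ∃ φ : cyclesWithEntryReplaced n → Equiv.Perm (Fin n),
      Function.Bijective φ ∧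
      ∀ τ : cyclesWithEntryReplaced n,
        descentSet (τ : Fin n → ℤ) = descentSet (oneLine (φ τ)) ∧
        ∀ k : Fin n, (τ : Fin n → ℤ) k = (n : ℤ) + 1 → oneLine (φ τ) k = (n : ℤ) := by
  obtain ⟨m, rfl⟩ : ∃ m, n = m + 1 := ⟨n - 1, by lia⟩
  obtain ⟨e, he⟩ := exists_equiv_descentSet m
  refine ⟨(cycleSeqEquiv m).symm.trans e, Equiv.bijective _, fun τ => ?_⟩
  obtain ⟨y, rfl⟩ := (cycleSeqEquiv m).surjective τ
  rw [Equiv.trans_apply, Equiv.symm_apply_apply]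
  refine ⟨(he y).1.symm, fun k hk => ?_⟩
  have hk' : y (Fin.last m) = k := (cycleSeq_eq_iff y k).1 hk
  have : e y k = Fin.last m := by
    rw [← hk', ← (he y).2, Equiv.Perm.inv_def, Equiv.apply_symm_apply]
  simp [oneLine, this]
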